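/- Let $\gamma_1\ge\gamma_2\ge\cdots>0$ be weights such that $\sum_{j\ge1}\gamma_j^{\lambda^*}<\infty$ for some $0<\lambda^*<1$. For $s\ge1$, $\alpha>1/2$ and $h\in\mathbb{Z}^s$ put $r_{\alpha,\gamma}(h)=\prod_{1\le j\le s,\,h_j\ne0}\gamma_j|h_j|^{-2\alpha}$, and let $H_{s,\alpha,\gamma}$ be the weighted Korobov space of real-valued periodic functions $f$ on $[0,1)^s$ that are given by their absolutely convergent Fourier series $f(x)=\sum_{h\in\mathbb{Z}^s}\hat f(h)e^{2\pi i h\cdot x}$ and have finite norm $\|f\|=\big(\sum_{h\in\mathbb{Z}^s}|\hat f(h)|^2/r_{\alpha,\gamma}(h)\big)^{1/2}$. For a family $P=(x_0,\dots,x_{N-1})$ of points of $[0,1)^s$ let $$e^{\mathrm{wor}}(H_{s,\alpha,\gamma},P)=\sup_{f\in H_{s,\alpha,\gamma},\ \|f\|\le1}\Big|\frac1N\sum_{n=0}^{N-1}f(x_n)-\int_{[0,1)^s}f(x)\,dx\Big|.$$ For $z\in\{1,\dots,N-1\}^d$ let $P_{N,d,z}$ be the rank-1 lattice with points $(\{nz_1/N\},\dots,\{nz_d/N\})$,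 $0\le n\le N-1$, where $\{\cdot\}$ denotes the fractional part. Say that $z$ is constructed by the component-by-component (CBC) algorithm if $z_1=1$ and, for $j=2,\dots,d$, $z_j$ minimizes $e^{\mathrm{wor}}(H_{j,\alpha,\gamma},P_{N,j,(z_1,\dots,z_{j-1},w)})^2$ over $w\in\{1,\dots,N-1\}$. Theorem. There is a constant $C>0$, depending only on $\gamma$ and $\lambda^*$, such that the following holds. Let $\alpha>1/2$, let $N,s,d$ be positive integers with $d<s$, let $z\in\{1,\dots,N-1\}^d$ be constructed by the CBC algorithm, let $c=(c_{d+1},\dots,c_s)\in[0,1)^{s-d}$, and let $P^{\mathrm{tr}}$ be the family of the points $(\{nz_1/N\},\dots,\{nz_d/N\},c_{d+1},\dots,c_s)$, $0\le n\le N-1$. Then for every $\lambda\in(\max(\lambda^*,1/(2\alpha)),1]$, $$e^{\mathrm{wor}}(H_{s,\alpha,\gamma},P^{\mathrm{tr}})^2\le\Big[\frac1{\varphi(N)}\Big(-1+\exp\big(2C^\lambda\zeta(2\alpha\lambda)\zeta(\lambda/\lambda^*)\big)\Big)\Big]^{1/\lambda}\exp\big(2C\zeta(2\alpha)\zeta(1/\lambda^*)\big)+\frac1{d^{1/\lambda^*-1}}\Big[-1+\exp\Big(\frac{2C\zeta(2\alpha)}{1/\lambda^*-1}\Big)\Big],$$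 where $\varphi$ is Euler's totient function and $\zeta$ the Riemann zeta function. -/

import Mathlib

open MeasureTheory

noncomputable section

/-- The unit cube `[0,1)^s`. -/
def unitCube (s : ℕ) : Set (Fin s → ℝ) :=
  Set.pi Set.univ fun _ => Set.Ico (0 : ℝ) 1

/-- The exponential `exp(2πi h·x)`. -/
def expMode {s : ℕ} (h : Fin s → ℤ) (x : Fin s → ℝ) : ℂ :=
  Complex.exp (2 * Real.pi * Complex.I * ∑ j, (h j : ℂ) * (x j : ℂ))

/-- The integral `I(f)` of `f` over the unit cube. -/
def cubeIntegral {s : ℕ} (f : (Fin s → ℝ) → ℝ) : ℝ :=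
  ∫ x in unitCube s, f x

/-- The `h`-th Fourier coefficient, the integral over the unit cube of
`f(x) exp(-2πi h·x)`. -/
def fourierCoefficient {s : ℕ} (f : (Fin s → ℝ) → ℝ) (h : Fin s → ℤ) : ℂ :=
  ∫ x in unitCube s, (f x : ℂ) * expMode (-h) x

/-- `r_{α,γ}(h)`, the product over all `j` with `h_j ≠ 0` of `γ_j / |h_j|^{2α}`.
Coordinates and weights are indexed from `0`: `γ 0, γ 1, …` are the weights
`γ_1, γ_2, …`. -/
def korobovR (s : ℕ) (α : ℝ) (γ : ℕ → ℝ) (h : Fin s → ℤ) : ℝ :=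
  ∏ j : Fin s, if h j = 0 then 1 else γ j / |(h j : ℝ)| ^ (2 * α)

/-- The weighted Korobov space `H_{s,α,γ}`: real functions which are given by their absolutely
convergent Fourier series and have finite norm. A periodic function on `[0,1)^s` is represented
by its periodic extension to `ℝ^s`; periodicity is part of being equal to the Fourier series. -/
def korobovSpace (s : ℕ) (α : ℝ) (γ : ℕ → ℝ) : Set ((Fin s → ℝ) → ℝ) :=
  {f | Summable (fun h : Fin s → ℤ => ‖fourierCoefficient f h‖) ∧
    (∀ x, HasSum (fun h : Fin s → ℤ => fourierCoefficient f h * expMode h x) (f x : ℂ)) ∧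
    Summable (fun h : Fin s → ℤ => ‖fourierCoefficient f h‖ ^ 2 / korobovR s α γ h)}

/-- The norm of `H_{s,α,γ}`: the square root of the sum over `h` of `|f̂(h)|² / r(h)`, where
`r(0) = 1`. -/
def korobovNorm (s : ℕ) (α : ℝ) (γ : ℕ → ℝ) (f : (Fin s → ℝ) → ℝ) : ℝ :=
  Real.sqrt (∑' h : Fin s → ℤ, ‖fourierCoefficient f h‖ ^ 2 / korobovR s α γ h)

/-- The equally weighted quadrature rule `I(f;P)` with the `N` points `P 0, …, P (N-1)`. -/
def quadratureRule {s N : ℕ} (P : Fin N → Fin s → ℝ) (f : (Fin s → ℝ) → ℝ) : ℝ :=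
  (1 / (N : ℝ)) * ∑ n, f (P n)

/-- The worst-case error `e^wor(H_{s,α,γ}, P)`, the supremum over the unit ball of `H_{s,α,γ}` of
`|I(f;P) - I(f)|`, taken in `[0,∞]`. -/
def worstCaseError {s N : ℕ} (α : ℝ) (γ : ℕ → ℝ) (P : Fin N → Fin s → ℝ) : ENNReal :=
  ⨆ f ∈ {f | f ∈ korobovSpace s α γ ∧ korobovNorm s α γ f ≤ 1},
    ENNReal.ofReal |quadratureRule P f - cubeIntegral f|

/-- The rank-1 lattice points `({n z_1 / N}, …, {n z_d / N})`, `0 ≤ n ≤ N - 1`. -/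
def latticePoints (N : ℕ) {d : ℕ} (z : Fin d → ℕ) : Fin N → Fin d → ℝ :=
  fun n j => Int.fract (((n : ℕ) : ℝ) * (z j : ℝ) / (N : ℝ))

/-- The first `j + 1` components of `z`. -/
def initialPart {d : ℕ} (z : Fin d → ℕ) (j : Fin d) : Fin (j.val + 1) → ℕ :=
  fun i => z ⟨i.val, by omega⟩

/-- `z ∈ {1,…,N-1}^d` is an output of the component-by-component algorithm: the first component
is `1`, and every later component minimizes the squared worst-case error in the space of the
coordinates up to its own, over all `w ∈ {1,…,N-1}`, with the previous components unchanged. -/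
structure IsCBC (N : ℕ) {d : ℕ} (α : ℝ) (γ : ℕ → ℝ) (z : Fin d → ℕ) : Prop where
  mem : ∀ j, z j ∈ Finset.Icc 1 (N - 1)
  first : ∀ j : Fin d, j.val = 0 → z j = 1
  argmin : ∀ j : Fin d, 0 < j.val → ∀ w ∈ Finset.Icc 1 (N - 1),
    worstCaseError α γ (latticePoints N (initialPart z j)) ^ 2 ≤
      worstCaseError α γ
        (latticePoints N (Function.update (initialPart z j) (Fin.last j.val) w)) ^ 2

/-- The points of the truncation algorithm,
`({n z_1 / N}, …, {n z_d / N}, c_{d+1}, …, c_s)`, `0 ≤ n ≤ N - 1`. The anchor `c` is indexed by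
the coordinates after the first `d`. -/
def truncatedPoints (N s d : ℕ) (z : Fin d → ℕ) (c : {j : Fin s // d ≤ j.val} → ℝ) :
    Fin N → Fin s → ℝ :=
  fun n j =>
    if hj : d ≤ j.val then c ⟨j, hj⟩ else latticePoints N z n ⟨j.val, not_le.mp hj⟩

/-- The Riemann zeta function at a real argument. -/
def realZeta (x : ℝ) : ℝ := (riemannZeta (x : ℂ)).re

end

/-! Cauchy–Schwarz on the Fourier side, with equality attained, gives the squared worst-case error
as the sum over h ≠ 0 of r(h)|A(h)|², where A(h) averages the mode h over the points
(`worstCaseError_sq`). The truncated points are the lattice with generator (z, 0, …, 0) shifted by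
the anchor. A shift only changes the phase of A(h), so |A(h)|² is the indicator of N ∣ h·z, and the
squared error is the dual sum E_s.

Coordinates with generator 0 impose no congruence, so by the product form of r, 1 + E_s = (1 + E_d)
Q, where Q is the product of 1 + 2γ_jζ(2α) over d < j ≤ s. Hence E_s = E_d Q + (Q - 1), which are
the two summands of the bound.

E_d is bounded by averaging: the CBC choice is no worse than any w coprime to N, and the mean over
these w of the λ-th power of the error increment is controlled by counting solutions of a linear
congruence (`IsCBC.totient_mul_dualError_rpow_le`). Q is bounded through γ_j ≤ C j^{-1/λ*};
convexity of exp extracts the power of d from Q - 1. -/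

/-! ### Zeta sums and the product structure of r -/

lemma realZeta_eq_tsum {s : ℝ} (hs : 1 < s) :
    realZeta s = ∑' n : ℕ, 1 / ((n : ℝ) + 1) ^ s := by
  have h : riemannZeta (s : ℂ) = ((∑' n : ℕ, 1 / ((n : ℝ) + 1) ^ s : ℝ) : ℂ) := by
    rw [zeta_eq_tsum_one_div_nat_add_one_cpow (by simpa using hs), Complex.ofReal_tsum]
    refine tsum_congr fun n => ?_
    have : (0 : ℝ) ≤ (n : ℝ) + 1 := by positivity
    push_cast [Complex.ofReal_cpow this]
    rfl
  rw [realZeta, h, Complex.ofReal_re]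

lemma summable_one_div_nat_add_one_rpow {s : ℝ} (hs : 1 < s) :
    Summable fun n : ℕ => 1 / ((n : ℝ) + 1) ^ s := by
  have := (summable_nat_add_iff 1).2 (Real.summable_one_div_nat_rpow.2 hs)
  simpa using this

lemma realZeta_nonneg {s : ℝ} (hs : 1 < s) : 0 ≤ realZeta s := by
  rw [realZeta_eq_tsum hs]
  exact tsum_nonneg fun n => by positivity

/-- The sum of `|k|^{-s}` over the nonzero integers. -/
lemma tsum_int_ne_zero_eq {s : ℝ} (hs : 1 < s) :
    ∑' k : ℤ, (if k = 0 then 0 else ENNReal.ofReal (1 / |(k : ℝ)| ^ s)) =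
      2 * ENNReal.ofReal (realZeta s) := by
  have hz : ENNReal.ofReal (realZeta s) =
      ∑' n : ℕ, ENNReal.ofReal (1 / ((n : ℝ) + 1) ^ s) := by
    rw [realZeta_eq_tsum hs, ENNReal.ofReal_tsum_of_nonneg (fun n => by positivity)
      (summable_one_div_nat_add_one_rpow hs)]
  rw [tsum_of_nat_of_neg_add_one ENNReal.summable ENNReal.summable,
    tsum_eq_zero_add' ENNReal.summable, two_mul, hz]
  have h1 (n : ℕ) : (0 : ℝ) ≤ (n : ℝ) + 1 := by positivity
  have h2 (n : ℕ) : ((n : ℤ) + 1) ≠ 0 := by positivity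
  have h3 (n : ℕ) : -1 + -(n : ℤ) ≠ 0 := by omega
  have h4 (n : ℕ) : |-1 + -(n : ℝ)| = n + 1 := by
    rw [← abs_neg, abs_of_nonneg] <;> [ring; linarith [h1 n]]
  simp [h2, h3, h4, abs_of_nonneg (h1 _)]

lemma korobovR_pos (s : ℕ) (α : ℝ) {γ : ℕ → ℝ} (hγ : ∀ j, 0 < γ j) (h : Fin s → ℤ) :
    0 < korobovR s α γ h := by
  refine Finset.prod_pos fun j _ => ?_
  split_ifs with hj
  · exact one_pos
  · have : (0 : ℝ) < |(h j : ℝ)| := by simpa using hj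
    have := hγ j
    positivity

lemma korobovR_zero (s : ℕ) (α : ℝ) (γ : ℕ → ℝ) : korobovR s α γ 0 = 1 := by
  simp [korobovR]

lemma korobovR_neg (s : ℕ) (α : ℝ) (γ : ℕ → ℝ) (h : Fin s → ℤ) :
    korobovR s α γ (-h) = korobovR s α γ h := by
  simp [korobovR]

/-- Powers of r stay in the same family, so estimates proved for all (α, γ) apply again after
raising to the power λ. -/
lemma korobovR_rpow (s : ℕ) (α : ℝ) {γ : ℕ → ℝ} (hγ : ∀ j, 0 < γ j) (lam : ℝ)
    (h : Fin s → ℤ) :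
    korobovR s α γ h ^ lam = korobovR s (α * lam) (fun j => γ j ^ lam) h := by
  have h0 (j : Fin s) : 0 ≤ γ j / |(h j : ℝ)| ^ (2 * α) := by
    have := hγ j
    positivity
  rw [korobovR, korobovR, ← Real.finsetProd_rpow]
  · refine Finset.prod_congr rfl fun j _ => ?_
    split_ifs with hj
    · simp
    · rw [Real.div_rpow (hγ j).le (by positivity), ← Real.rpow_mul (by positivity), mul_assoc]
  · intro j _
    split_ifs
    · exact zero_le_one
    · exact h0 j

lemma korobovR_snoc (s : ℕ) (α : ℝ) (γ : ℕ → ℝ) (h : Fin s → ℤ) (k : ℤ) :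
    korobovR (s + 1) α γ (Fin.snoc h k : Fin (s + 1) → ℤ) =
      korobovR s α γ h * (if k = 0 then 1 else γ s / |(k : ℝ)| ^ (2 * α)) := by
  simp [korobovR, Fin.prod_univ_castSucc]

lemma tsum_fin_snoc {s : ℕ} (f : (Fin (s + 1) → ℤ) → ENNReal) :
    ∑' h, f h = ∑' (h : Fin s → ℤ) (k : ℤ), f (Fin.snoc h k : Fin (s + 1) → ℤ) := by
  rw [← (Fin.snocEquiv fun _ => ℤ).tsum_eq f, ENNReal.tsum_comm, ← ENNReal.tsum_prod]
  rfl

/-- The sum of `γ |k|^{-2α}` over the nonzero integers `k`. -/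
lemma tsum_weight_ne_zero {α g : ℝ} (hα : 1 / 2 < α) (hg : 0 ≤ g) :
    ∑' k : ℤ, (if k = 0 then 0 else ENNReal.ofReal (g / |(k : ℝ)| ^ (2 * α))) =
      ENNReal.ofReal (2 * g * realZeta (2 * α)) := by
  rw [mul_comm 2 g, mul_assoc, ENNReal.ofReal_mul hg, ENNReal.ofReal_mul zero_le_two,
    ENNReal.ofReal_ofNat, ← tsum_int_ne_zero_eq (by linarith), ← ENNReal.tsum_mul_left]
  refine tsum_congr fun k => ?_
  split_ifs
  · simp
  · rw [← ENNReal.ofReal_mul hg, mul_one_div]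

/-- The sum factors over coordinates; in each one, k = 0 contributes 1 and the nonzero k contribute
2γ_jζ(2α). -/
lemma tsum_korobovR {α : ℝ} (hα : 1 / 2 < α) {γ : ℕ → ℝ} (hγ : ∀ j, 0 < γ j) (s : ℕ) :
    ∑' h : Fin s → ℤ, ENNReal.ofReal (korobovR s α γ h) =
      ENNReal.ofReal (∏ j ∈ Finset.range s, (1 + 2 * γ j * realZeta (2 * α))) := by
  have hz : 0 ≤ realZeta (2 * α) := realZeta_nonneg (by linarith)
  have h0 (j : ℕ) : 0 ≤ 2 * γ j * realZeta (2 * α) := by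
    have := hγ j
    positivity
  induction s with
  | zero => simp [korobovR, tsum_fintype]
  | succ s ih =>
    rw [tsum_fin_snoc, Finset.prod_range_succ,
      ENNReal.ofReal_mul (Finset.prod_nonneg fun j _ => by linarith [h0 j]), ← ih,
      ENNReal.ofReal_add zero_le_one (h0 s), ← tsum_weight_ne_zero hα (hγ s).le,
      ← ENNReal.tsum_mul_right]
    refine tsum_congr fun h => ?_
    simp_rw [korobovR_snoc, ENNReal.ofReal_mul (korobovR_pos s α hγ h).le]
    rw [ENNReal.tsum_mul_left, ENNReal.tsum_eq_add_tsum_ite 0]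
    refine congrArg (ENNReal.ofReal _ * ·) (congrArg₂ (· + ·) ?_ (tsum_congr fun k => ?_))
    · simp
    · split_ifs <;> rfl

lemma summable_korobovR {α : ℝ} (hα : 1 / 2 < α) {γ : ℕ → ℝ} (hγ : ∀ j, 0 < γ j) (s : ℕ) :
    Summable (korobovR s α γ) := by
  have h := tsum_korobovR hα hγ s
  have h' := ENNReal.summable_toReal (h.trans_ne ENNReal.ofReal_ne_top)
  simpa [ENNReal.toReal_ofReal (korobovR_pos s α hγ _).le] using h'

/-! ### Dual sums and their recursion in the dimension -/

/-- The sum of `r(h)` over the nonzero `h` with `N ∣ h·Z`. -/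
noncomputable def dualError (s N : ℕ) (α : ℝ) (γ : ℕ → ℝ) (Z : ℕ → ℤ) : ENNReal :=
  ∑' h : Fin s → ℤ, if h ≠ 0 ∧ (N : ℤ) ∣ ∑ j, h j * Z j then
    ENNReal.ofReal (korobovR s α γ h) else 0

/-- The part of `dualError (s + 1)` that comes from the `h` with nonzero last component. -/
noncomputable def dualIncrement (s N : ℕ) (α : ℝ) (γ : ℕ → ℝ) (Z : ℕ → ℤ) (w : ℤ) : ENNReal :=
  ∑' (h : Fin s → ℤ) (k : ℤ), if k ≠ 0 ∧ (N : ℤ) ∣ ∑ j, h j * Z j + k * w then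
    ENNReal.ofReal (korobovR s α γ h) * ENNReal.ofReal (γ s / |(k : ℝ)| ^ (2 * α)) else 0

lemma dualError_congr {s N : ℕ} {α : ℝ} {γ : ℕ → ℝ} {Z Z' : ℕ → ℤ} (h : ∀ j < s, Z j = Z' j) :
    dualError s N α γ Z = dualError s N α γ Z' := by
  have (g : Fin s → ℤ) : ∑ j, g j * Z j = ∑ j, g j * Z' j :=
    Finset.sum_congr rfl fun j _ => by rw [h j j.2]
  simp only [dualError, this]

lemma dualIncrement_congr {s N : ℕ} {α : ℝ} {γ : ℕ → ℝ} {Z Z' : ℕ → ℤ} (h : ∀ j < s, Z j = Z' j)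
    (w : ℤ) : dualIncrement s N α γ Z w = dualIncrement s N α γ Z' w := by
  have (g : Fin s → ℤ) : ∑ j, g j * Z j = ∑ j, g j * Z' j :=
    Finset.sum_congr rfl fun j _ => by rw [h j j.2]
  simp only [dualIncrement, this]

lemma dualError_zero (N : ℕ) (α : ℝ) (γ : ℕ → ℝ) (Z : ℕ → ℤ) : dualError 0 N α γ Z = 0 := by
  
  refine ENNReal.tsum_eq_zero.2 fun h => if_neg fun H => H.1 (Subsingleton.elim _ _)

lemma snoc_eq_zero_iff {s : ℕ} (h : Fin s → ℤ) (k : ℤ) :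
    (Fin.snoc h k : Fin (s + 1) → ℤ) = 0 ↔ h = 0 ∧ k = 0 := by
  constructor
  · intro H
    refine ⟨funext fun j => ?_, ?_⟩
    · simpa using congrFun H j.castSucc
    · simpa using congrFun H (Fin.last s)
  · rintro ⟨rfl, rfl⟩
    funext j
    refine Fin.lastCases ?_ (fun i => ?_) j <;> simp

lemma dualError_succ (s N : ℕ) (α : ℝ) {γ : ℕ → ℝ} (hγ : ∀ j, 0 < γ j) (Z : ℕ → ℤ) :
    dualError (s + 1) N α γ Z = dualError s N α γ Z + dualIncrement s N α γ Z (Z s) := by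
  rw [dualError, tsum_fin_snoc, dualError, dualIncrement, ← ENNReal.tsum_add]
  refine tsum_congr fun h => ?_
  simp only [Ne, snoc_eq_zero_iff, korobovR_snoc, Fin.sum_univ_castSucc, Fin.snoc_castSucc,
    Fin.snoc_last, Fin.val_castSucc, Fin.val_last]
  rw [ENNReal.tsum_eq_add_tsum_ite 0]
  congr 1
  · simp
  · refine tsum_congr fun k => ?_
    by_cases hk : k = 0
    · simp [hk]
    · simp [hk, ENNReal.ofReal_mul (korobovR_pos s α hγ h).le]

lemma dualError_ne_top {α : ℝ} (hα : 1 / 2 < α) {γ : ℕ → ℝ} (hγ : ∀ j, 0 < γ j) (s N : ℕ)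
    (Z : ℕ → ℤ) : dualError s N α γ Z ≠ ⊤ := by
  refine ne_top_of_le_ne_top ((tsum_korobovR hα hγ s).trans_ne ENNReal.ofReal_ne_top) ?_
  refine ENNReal.tsum_le_tsum fun h => ?_
  split_ifs <;> simp

/-- A coordinate with generator `0` multiplies `1 + dualError` by `1 + 2γζ(2α)`. -/
lemma one_add_dualError_succ_of_eq_zero {α : ℝ} (hα : 1 / 2 < α) {γ : ℕ → ℝ}
    (hγ : ∀ j, 0 < γ j) (s N : ℕ) {Z : ℕ → ℤ} (hZ : Z s = 0) :
    1 + dualError (s + 1) N α γ Z =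
      (1 + dualError s N α γ Z) * ENNReal.ofReal (1 + 2 * γ s * realZeta (2 * α)) := by
  have hz : 0 ≤ realZeta (2 * α) := realZeta_nonneg (by linarith)
  have hg := hγ s
  -- The 1 is r(0): it removes the restriction h ≠ 0, and the sum over (h, k) then factors.
  have h1 : 1 + dualError s N α γ Z = ∑' h : Fin s → ℤ, if (N : ℤ) ∣ ∑ j, h j * Z j then
      ENNReal.ofReal (korobovR s α γ h) else 0 := by
    rw [ENNReal.tsum_eq_add_tsum_ite 0]
    congr 1
    · simp [korobovR_zero]
    · refine tsum_congr fun h => ?_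
      by_cases hh : h = 0 <;> simp [hh]
  have h2 : dualIncrement s N α γ Z 0 =
      (1 + dualError s N α γ Z) * ENNReal.ofReal (2 * γ s * realZeta (2 * α)) := by
    rw [h1, dualIncrement, ← ENNReal.tsum_mul_right]
    refine tsum_congr fun h => ?_
    rw [← tsum_weight_ne_zero hα (hγ s).le, ← ENNReal.tsum_mul_left]
    refine tsum_congr fun k => ?_
    by_cases hk : k = 0 <;> simp [hk]
  rw [dualError_succ s N α hγ, hZ, h2, ENNReal.ofReal_add zero_le_one (by positivity)]
  simp only [ENNReal.ofReal_one]
  ring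

lemma one_add_dualError_of_eq_zero {α : ℝ} (hα : 1 / 2 < α) {γ : ℕ → ℝ}
    (hγ : ∀ j, 0 < γ j) {d s : ℕ} (hds : d ≤ s) (N : ℕ) {Z : ℕ → ℤ} (hZ : ∀ j, d ≤ j → Z j = 0) :
    1 + dualError s N α γ Z = (1 + dualError d N α γ Z) *
      ENNReal.ofReal (∏ j ∈ Finset.Ico d s, (1 + 2 * γ j * realZeta (2 * α))) := by
  have hz : 0 ≤ realZeta (2 * α) := realZeta_nonneg (by linarith)
  induction s, hds using Nat.le_induction with
  | base => simp
  | succ s hs ih =>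
    rw [one_add_dualError_succ_of_eq_zero hα hγ s N (hZ s hs), ih,
      Finset.prod_Ico_succ_top hs, mul_assoc, ENNReal.ofReal_mul]
    exact Finset.prod_nonneg fun j _ => by have := hγ j; positivity

/-! ### Fourier modes and the worst-case error formula -/

lemma tsum_mul_sq_le {ι : Type*} {f g : ι → ℝ} (hf0 : ∀ i, 0 ≤ f i) (hg0 : ∀ i, 0 ≤ g i)
    (hf : Summable fun i => f i ^ 2) (hg : Summable fun i => g i ^ 2) :
    Summable (fun i => f i * g i) ∧
      (∑' i, f i * g i) ^ 2 ≤ (∑' i, f i ^ 2) * ∑' i, g i ^ 2 := by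
  have h := Real.summable_and_inner_le_Lp_mul_Lq_tsum_of_nonneg Real.HolderConjugate.two_two
    hf0 hg0 (by simpa using hf) (by simpa using hg)
  refine ⟨h.1, ?_⟩
  have h2 := h.2
  simp only [Real.rpow_two, ← Real.sqrt_eq_rpow] at h2
  rw [← Real.sqrt_mul (tsum_nonneg fun i => sq_nonneg _)] at h2
  exact (Real.le_sqrt (tsum_nonneg fun i => mul_nonneg (hf0 i) (hg0 i)) (mul_nonneg
    (tsum_nonneg fun i => sq_nonneg _) (tsum_nonneg fun i => sq_nonneg _))).1 h2

lemma expMode_eq_exp {s : ℕ} (h : Fin s → ℤ) (x : Fin s → ℝ) :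
    expMode h x = Complex.exp ((2 * Real.pi * ∑ j, (h j : ℝ) * x j : ℝ) * Complex.I) := by
  rw [expMode]
  push_cast
  ring_nf

lemma norm_expMode {s : ℕ} (h : Fin s → ℤ) (x : Fin s → ℝ) : ‖expMode h x‖ = 1 := by
  rw [expMode_eq_exp, Complex.norm_exp_ofReal_mul_I]

lemma expMode_zero {s : ℕ} (x : Fin s → ℝ) : expMode 0 x = 1 := by
  simp [expMode]

lemma expMode_neg {s : ℕ} (h : Fin s → ℤ) (x : Fin s → ℝ) :
    expMode (-h) x = starRingEnd ℂ (expMode h x) := by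
  rw [expMode_eq_exp, expMode_eq_exp, ← Complex.exp_conj, map_mul, Complex.conj_ofReal,
    Complex.conj_I]
  simp

lemma expMode_mul_neg {s : ℕ} (h k : Fin s → ℤ) (x : Fin s → ℝ) :
    expMode h x * expMode (-k) x = expMode (h - k) x := by
  rw [expMode, expMode, expMode, ← Complex.exp_add, ← mul_add, ← Finset.sum_add_distrib]
  congr 2
  refine Finset.sum_congr rfl fun j _ => ?_
  simp only [Pi.neg_apply, Pi.sub_apply]
  push_cast
  ring

lemma continuous_expMode {s : ℕ} (h : Fin s → ℤ) : Continuous (expMode h) := by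
  unfold expMode
  fun_prop

lemma volume_restrict_unitCube (s : ℕ) :
    (volume : Measure (Fin s → ℝ)).restrict (unitCube s) =
      Measure.pi fun _ => volume.restrict (Set.Ico (0 : ℝ) 1) := by
  rw [unitCube, volume_pi, Measure.restrict_pi_pi]

instance isProbabilityMeasure_unitInterval :
    IsProbabilityMeasure (volume.restrict (Set.Ico (0 : ℝ) 1)) := ⟨by simp⟩

instance isProbabilityMeasure_unitCube (s : ℕ) :
    IsProbabilityMeasure ((volume : Measure (Fin s → ℝ)).restrict (unitCube s)) := by
  rw [volume_restrict_unitCube]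
  infer_instance

lemma integral_exp_int_mul (k : ℤ) :
    ∫ x in Set.Ico (0 : ℝ) 1, Complex.exp (2 * Real.pi * Complex.I * (k * x)) =
      if k = 0 then 1 else 0 := by
  split_ifs with hk
  · simp [hk]
  · rw [integral_Ico_eq_integral_Ioc, ← intervalIntegral.integral_of_le zero_le_one]
    have hc : 2 * Real.pi * Complex.I * (k : ℂ) ≠ 0 := by
      simp [hk, Real.pi_ne_zero, Complex.I_ne_zero]
    simp_rw [← mul_assoc]
    rw [integral_exp_mul_complex hc]
    have : Complex.exp (2 * Real.pi * Complex.I * k) = 1 := by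
      rw [mul_comm]
      exact Complex.exp_int_mul_two_pi_mul_I k
    simp [this]

lemma integral_expMode {s : ℕ} (h : Fin s → ℤ) :
    ∫ x in unitCube s, expMode h x = if h = 0 then 1 else 0 := by
  have (x : Fin s → ℝ) : expMode h x =
      ∏ j, Complex.exp (2 * Real.pi * Complex.I * ((h j : ℂ) * (x j : ℂ))) := by
    rw [expMode, Finset.mul_sum, Complex.exp_sum]
  simp_rw [this]
  rw [volume_restrict_unitCube, integral_fintype_prod_eq_prod
    (fun j (x : ℝ) => Complex.exp (2 * Real.pi * Complex.I * ((h j : ℂ) * (x : ℂ))))]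
  simp_rw [integral_exp_int_mul]
  split_ifs with hh
  · simp [hh]
  · obtain ⟨j, hj⟩ := Function.ne_iff.1 hh
    exact Finset.prod_eq_zero (Finset.mem_univ j) (if_neg hj)

/-- An absolutely convergent Fourier series has the expected Fourier coefficients. -/
lemma fourierCoefficient_of_hasSum {s : ℕ} {f : (Fin s → ℝ) → ℝ} {c : (Fin s → ℤ) → ℂ}
    (hc : Summable fun h => ‖c h‖)
    (hf : ∀ x, HasSum (fun h => c h * expMode h x) (f x : ℂ)) (k : Fin s → ℤ) :
    fourierCoefficient f k = c k := by
  have h1 (x : Fin s → ℝ) : (f x : ℂ) * expMode (-k) x = ∑' h, c h * expMode (h - k) x := by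
    rw [← ((hf x).mul_right (expMode (-k) x)).tsum_eq]
    simp_rw [mul_assoc, expMode_mul_neg]
  have h2 (h : Fin s → ℤ) : Integrable (fun x => c h * expMode (h - k) x)
      (volume.restrict (unitCube s)) := by
    refine Integrable.const_mul (Integrable.of_bound
      (continuous_expMode _).aestronglyMeasurable 1 ?_) _
    exact Filter.Eventually.of_forall fun x => (norm_expMode _ _).le
  have h3 := hasSum_integral_of_summable_integral_norm h2 (by simpa [norm_expMode] using hc)
  rw [fourierCoefficient]
  simp_rw [h1]
  rw [← h3.tsum_eq, tsum_eq_single k]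
  · rw [integral_const_mul, integral_expMode]
    simp
  · intro h hk
    rw [integral_const_mul, integral_expMode, if_neg (sub_ne_zero.2 hk), mul_zero]

lemma fourierCoefficient_zero {s : ℕ} (f : (Fin s → ℝ) → ℝ) :
    fourierCoefficient f 0 = (cubeIntegral f : ℂ) := by
  simp [fourierCoefficient, cubeIntegral, expMode_zero, integral_complex_ofReal]

/-- The mean of `exp(2πi h·x)` over the points of `P`. -/
noncomputable def pointMean {s N : ℕ} (P : Fin N → Fin s → ℝ) (h : Fin s → ℤ) : ℂ :=
  (1 / (N : ℂ)) * ∑ n, expMode h (P n)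

section WorstCase

variable {s N : ℕ} (P : Fin N → Fin s → ℝ)

lemma pointMean_zero (hN : 0 < N) : pointMean P 0 = 1 := by
  have : (N : ℂ) ≠ 0 := by exact_mod_cast hN.ne'
  simp [pointMean, expMode_zero, this]

lemma pointMean_neg (h : Fin s → ℤ) : pointMean P (-h) = starRingEnd ℂ (pointMean P h) := by
  simp [pointMean, expMode_neg]

lemma norm_pointMean_le_one (h : Fin s → ℤ) : ‖pointMean P h‖ ≤ 1 := by
  rw [pointMean, norm_mul]
  have h1 : ‖∑ n, expMode h (P n)‖ ≤ N := by
    refine (norm_sum_le _ _).trans ?_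
    simp [norm_expMode]
  have h2 : ‖1 / (N : ℂ)‖ = 1 / (N : ℝ) := by simp
  rw [h2, one_div, inv_mul_eq_div]
  exact div_le_one_of_le₀ h1 (Nat.cast_nonneg N)

/-- The summand of the squared worst-case error. -/
noncomputable def errorTerm (α : ℝ) (γ : ℕ → ℝ) (h : Fin s → ℤ) : ℝ :=
  if h = 0 then 0 else korobovR s α γ h * ‖pointMean P h‖ ^ 2

variable {α : ℝ} {γ : ℕ → ℝ}

lemma errorTerm_nonneg (hγ : ∀ j, 0 < γ j) (h : Fin s → ℤ) : 0 ≤ errorTerm P α γ h := by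
  have := korobovR_pos s α hγ h
  rw [errorTerm]
  split_ifs <;> positivity

lemma summable_errorTerm (hα : 1 / 2 < α) (hγ : ∀ j, 0 < γ j) :
    Summable (errorTerm P α γ) := by
  refine (summable_korobovR hα hγ s).of_nonneg_of_le (errorTerm_nonneg P hγ) fun h => ?_
  have := korobovR_pos s α hγ h
  rw [errorTerm]
  split_ifs
  · exact this.le
  · exact mul_le_of_le_one_right this.le (pow_le_one₀ (norm_nonneg _) (norm_pointMean_le_one P h))

/-- Averaging the Fourier series over the points replaces each mode by its mean, and the term h = 0
cancels the integral. -/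
lemma hasSum_quadratureRule_sub (hN : 0 < N) {f : (Fin s → ℝ) → ℝ} {c : (Fin s → ℤ) → ℂ}
    (hc0 : c 0 = (cubeIntegral f : ℂ))
    (hf : ∀ x, HasSum (fun h => c h * expMode h x) (f x : ℂ)) :
    HasSum (fun h => if h = 0 then 0 else c h * pointMean P h)
      ((quadratureRule P f - cubeIntegral f : ℝ) : ℂ) := by
  have h1 : HasSum (fun h => c h * pointMean P h) ((quadratureRule P f : ℝ) : ℂ) := by
    have := (hasSum_sum fun n (_ : n ∈ Finset.univ) => hf (P n)).mul_left (1 / (N : ℂ))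
    have e1 : (fun h => c h * pointMean P h) =
        fun h => 1 / (N : ℂ) * ∑ n, c h * expMode h (P n) := by
      funext h
      rw [pointMean, ← Finset.mul_sum]
      ring
    have e2 : ((quadratureRule P f : ℝ) : ℂ) = 1 / (N : ℂ) * ∑ n, (f (P n) : ℂ) := by
      simp [quadratureRule]
    rw [e1, e2]
    exact this
  have h2 := h1.sub (hasSum_ite_eq (0 : Fin s → ℤ) (cubeIntegral f : ℂ))
  have e : (fun h => if h = 0 then 0 else c h * pointMean P h) =
      fun h => c h * pointMean P h - if h = 0 then (cubeIntegral f : ℂ) else 0 := by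
    funext h
    split_ifs with hh
    · simp [hh, hc0, pointMean_zero P hN]
    · simp
  rw [e, Complex.ofReal_sub]
  exact h2

/-- Cauchy–Schwarz, splitting each term as (|c(h)|/√r(h)) · (√r(h) |A(h)|). -/
lemma abs_quadratureRule_sub_sq_le (hN : 0 < N) (hα : 1 / 2 < α) (hγ : ∀ j, 0 < γ j)
    {f : (Fin s → ℝ) → ℝ} (hf : f ∈ korobovSpace s α γ) (hf1 : korobovNorm s α γ f ≤ 1) :
    |quadratureRule P f - cubeIntegral f| ^ 2 ≤ ∑' h, errorTerm P α γ h := by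
  obtain ⟨-, hfx, hf2⟩ := hf
  set c := fourierCoefficient f
  have hr := korobovR_pos s α hγ
  have hsum := hasSum_quadratureRule_sub P hN (fourierCoefficient_zero f) hfx
  have ha (h) : (‖c h‖ / √(korobovR s α γ h)) ^ 2 = ‖c h‖ ^ 2 / korobovR s α γ h := by
    rw [div_pow, Real.sq_sqrt (hr h).le]
  have hb (h) : √(errorTerm P α γ h) ^ 2 = errorTerm P α γ h :=
    Real.sq_sqrt (errorTerm_nonneg P hγ h)
  have hab (h) : ‖if h = 0 then 0 else c h * pointMean P h‖ =
      ‖c h‖ / √(korobovR s α γ h) * √(errorTerm P α γ h) := by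
    rw [errorTerm]
    split_ifs
    · simp
    · rw [Real.sqrt_mul (hr h).le, Real.sqrt_sq (norm_nonneg _), norm_mul]
      have := (Real.sqrt_pos.2 (hr h)).ne'
      field_simp
  obtain ⟨hs, hle⟩ := tsum_mul_sq_le (f := fun h => ‖c h‖ / √(korobovR s α γ h))
    (g := fun h => √(errorTerm P α γ h)) (fun h => by positivity) (fun h => by positivity)
    (by simpa only [ha] using hf2) (by simpa only [hb] using summable_errorTerm P hα hγ)
  simp only [ha, hb, ← hab] at hs hle
  have h1 : ∑' h, ‖c h‖ ^ 2 / korobovR s α γ h ≤ 1 := by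
    have := (Real.sqrt_le_left zero_le_one).1 hf1
    simpa using this
  have h2 : |quadratureRule P f - cubeIntegral f| ≤
      ∑' h, ‖if h = 0 then 0 else c h * pointMean P h‖ := by
    rw [← Real.norm_eq_abs, ← Complex.norm_real, ← hsum.tsum_eq]
    exact norm_tsum_le_tsum_norm hs
  calc |quadratureRule P f - cubeIntegral f| ^ 2
      ≤ _ := pow_le_pow_left₀ (abs_nonneg _) h2 2
    _ ≤ _ := hle
    _ ≤ 1 * ∑' h, errorTerm P α γ h :=
        mul_le_mul_of_nonneg_right h1 (tsum_nonneg (errorTerm_nonneg P hγ))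
    _ = _ := one_mul _

/-- Equality in Cauchy–Schwarz: the extremal function is the normalized Riesz representer of the
error functional, with coefficients r(h) times the conjugate of A(h), divided by √E. -/
lemma exists_quadratureRule_sub_eq (hN : 0 < N) (hα : 1 / 2 < α) (hγ : ∀ j, 0 < γ j)
    (hE : 0 < ∑' h, errorTerm P α γ h) :
    ∃ f ∈ korobovSpace s α γ, korobovNorm s α γ f ≤ 1 ∧
      quadratureRule P f - cubeIntegral f = √(∑' h, errorTerm P α γ h) := by
  set E := ∑' h, errorTerm P α γ h with hEdef
  have hr := korobovR_pos s α hγ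
  let c : (Fin s → ℤ) → ℂ := fun h => if h = 0 then 0 else
    ((korobovR s α γ h / √E : ℝ) : ℂ) * starRingEnd ℂ (pointMean P h)
  -- This symmetry makes the series real-valued.
  have hcneg (h) : c (-h) = starRingEnd ℂ (c h) := by
    simp only [c, neg_eq_zero]
    split_ifs
    · simp
    · rw [korobovR_neg, pointMean_neg, map_mul, Complex.conj_ofReal]
  have hcnorm (h) : ‖c h‖ = if h = 0 then 0 else korobovR s α γ h / √E * ‖pointMean P h‖ := by
    simp only [c]
    split_ifs
    · simp
    · rw [norm_mul, Complex.norm_real, RCLike.norm_conj, Real.norm_of_nonneg]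
      have := hr h
      positivity
  have hcs : Summable fun h => ‖c h‖ := by
    refine ((summable_korobovR hα hγ s).div_const (√E)).of_nonneg_of_le
      (fun h => norm_nonneg _) fun h => ?_
    rw [hcnorm]
    have := hr h
    split_ifs
    · positivity
    · exact mul_le_of_le_one_right (by positivity) (norm_pointMean_le_one P h)
  have hcsx (x) : Summable fun h => c h * expMode h x :=
    Summable.of_norm (by simpa [norm_expMode] using hcs)
  have hconj (x) : starRingEnd ℂ (∑' h, c h * expMode h x) = ∑' h, c h * expMode h x := by
    rw [Complex.conj_tsum, ← (Equiv.neg (Fin s → ℤ)).tsum_eq (fun h => c h * expMode h x)]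
    refine tsum_congr fun h => ?_
    simp [hcneg, expMode_neg]
  let f : (Fin s → ℝ) → ℝ := fun x => (∑' h, c h * expMode h x).re
  have hf (x) : HasSum (fun h => c h * expMode h x) (f x : ℂ) := by
    have : (f x : ℂ) = ∑' h, c h * expMode h x := Complex.conj_eq_iff_re.1 (hconj x)
    rw [this]
    exact (hcsx x).hasSum
  have hcoef : fourierCoefficient f = c := funext (fourierCoefficient_of_hasSum hcs hf)
  have hsq (h) : ‖c h‖ ^ 2 / korobovR s α γ h = errorTerm P α γ h / E := by
    rw [hcnorm, errorTerm]
    have := (hr h).ne'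
    split_ifs
    · simp
    · rw [mul_pow, div_pow, Real.sq_sqrt hE.le]
      field_simp
  have hnorm : ∑' h, ‖c h‖ ^ 2 / korobovR s α γ h = 1 := by
    simp_rw [hsq]
    rw [tsum_div_const, ← hEdef, div_self hE.ne']
  refine ⟨f, ⟨?_, ?_, ?_⟩, ?_, ?_⟩
  · rwa [hcoef]
  · rwa [hcoef]
  · simp_rw [hcoef, hsq]
    exact (summable_errorTerm P hα hγ).div_const E
  · rw [korobovNorm, hcoef, hnorm, Real.sqrt_one]
  · have h1 := hasSum_quadratureRule_sub P hN (hcoef ▸ fourierCoefficient_zero f) hf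
    have h2 : HasSum (fun h => if h = 0 then 0 else c h * pointMean P h) ((√E : ℝ) : ℂ) := by
      have h3 := ((summable_errorTerm P hα hγ).hasSum.div_const (√E)).mapL Complex.ofRealCLM
      rw [← hEdef, Real.div_sqrt] at h3
      have e : (fun h => if h = 0 then 0 else c h * pointMean P h) =
          fun h => Complex.ofRealCLM (errorTerm P α γ h / √E) := by
        funext h
        simp only [c, errorTerm, Complex.ofRealCLM_apply]
        split_ifs
        · simp
        · rw [mul_assoc, Complex.conj_mul']
          push_cast
          ring
      rw [e]
      exact h3
    exact_mod_cast h1.unique h2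

/-- The squared worst-case error is the sum of `r(h) |A(h)|²` over the nonzero `h`, where `A(h)`
is the mean of `exp(2πi h·x)` over the points. -/
theorem worstCaseError_sq (hN : 0 < N) (hα : 1 / 2 < α) (hγ : ∀ j, 0 < γ j) :
    worstCaseError α γ P ^ 2 = ∑' h, ENNReal.ofReal (errorTerm P α γ h) := by
  have hE : 0 ≤ ∑' h, errorTerm P α γ h := tsum_nonneg (errorTerm_nonneg P hγ)
  rw [← ENNReal.ofReal_tsum_of_nonneg (errorTerm_nonneg P hγ) (summable_errorTerm P hα hγ)]
  have key : worstCaseError α γ P = ENNReal.ofReal √(∑' h, errorTerm P α γ h) := by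
    refine le_antisymm (iSup₂_le fun f hf => ENNReal.ofReal_le_ofReal ?_) ?_
    · exact Real.le_sqrt_of_sq_le (abs_quadratureRule_sub_sq_le P hN hα hγ hf.1 hf.2)
    · rcases hE.eq_or_lt with h0 | h0
      · simp [← h0]
      · obtain ⟨f, hf, hf1, hfe⟩ := exists_quadratureRule_sub_eq P hN hα hγ h0
        refine le_iSup₂_of_le f ⟨hf, hf1⟩ (ENNReal.ofReal_le_ofReal ?_)
        rw [hfe]
        exact le_abs_self _
  rw [key, ← ENNReal.ofReal_pow (Real.sqrt_nonneg _), Real.sq_sqrt hE]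

end WorstCase

/-! ### Character property of shifted lattices and CBC minimality -/

/-- The generating vector, extended by zeros. -/
def extendByZero {d : ℕ} (z : Fin d → ℕ) (i : ℕ) : ℤ :=
  if hi : i < d then z ⟨i, hi⟩ else 0

lemma sum_pow_root_of_unity {N : ℕ} (hN : 0 < N) (M : ℤ) :
    ∑ n : Fin N, Complex.exp (2 * Real.pi * Complex.I * (M / N)) ^ (n : ℕ) =
      if (N : ℤ) ∣ M then (N : ℂ) else 0 := by
  have hN' : (N : ℂ) ≠ 0 := by exact_mod_cast hN.ne'
  rw [Fin.sum_univ_eq_sum_range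
    (fun n => Complex.exp (2 * Real.pi * Complex.I * ((M : ℂ) / N)) ^ n)]
  have h1 : Complex.exp (2 * Real.pi * Complex.I * ((M : ℂ) / N)) = 1 ↔ (N : ℤ) ∣ M := by
    rw [Complex.exp_eq_one_iff]
    have h2 : 2 * (Real.pi : ℂ) * Complex.I ≠ 0 := Complex.two_pi_I_ne_zero
    constructor
    · rintro ⟨n, hn⟩
      rw [mul_comm (n : ℂ), mul_right_inj' h2, div_eq_iff hN'] at hn
      exact ⟨n, by rw [mul_comm]; exact_mod_cast hn⟩
    · rintro ⟨n, rfl⟩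
      refine ⟨n, ?_⟩
      push_cast
      field_simp
  split_ifs with hM
  · rw [h1.2 hM]
    simp
  · have h3 := mul_neg_geom_sum (Complex.exp (2 * Real.pi * Complex.I * ((M : ℂ) / N))) N
    have h4 : Complex.exp (2 * Real.pi * Complex.I * ((M : ℂ) / N)) ^ N = 1 := by
      rw [← Complex.exp_nat_mul, Complex.exp_eq_one_iff]
      exact ⟨M, by field_simp⟩
    rw [h4, sub_self] at h3
    refine (mul_eq_zero.1 h3).resolve_left fun h => hM (h1.1 ?_)
    exact (sub_eq_zero.1 h).symm

/-- The character property of (shifted) lattice points. -/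
lemma norm_pointMean_sq_of_lattice {s N : ℕ} (hN : 0 < N) {P : Fin N → Fin s → ℝ} {Z : ℕ → ℤ}
    {a : Fin s → ℝ} {m : Fin N → Fin s → ℤ}
    (hP : ∀ n j, P n j = (n : ℕ) * (Z j : ℝ) / N + a j + m n j) (h : Fin s → ℤ) :
    ‖pointMean P h‖ ^ 2 = if (N : ℤ) ∣ ∑ j, h j * Z j then 1 else 0 := by
  have hN' : (N : ℂ) ≠ 0 := by exact_mod_cast hN.ne'
  have key (n : Fin N) : expMode h (P n) = expMode h a *
      Complex.exp (2 * Real.pi * Complex.I * ((∑ j, h j * Z j : ℤ) / N)) ^ (n : ℕ) := by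
    -- The shift gives a factor of modulus 1, the integer part m gives exp = 1, and what remains is
    -- the n-th power of an N-th root of unity.
    have h1 : ∑ j, (h j : ℂ) * (P n j : ℂ) = ∑ j, (h j : ℂ) * (a j : ℂ) +
        (n : ℕ) * ((∑ j, h j * Z j : ℤ) / N) + (∑ j, h j * m n j : ℤ) := by
      push_cast
      rw [Finset.sum_div, Finset.mul_sum, ← Finset.sum_add_distrib, ← Finset.sum_add_distrib]
      refine Finset.sum_congr rfl fun j _ => ?_
      rw [hP]
      push_cast
      ring
    rw [expMode, expMode, h1, mul_add, mul_add, Complex.exp_add, Complex.exp_add,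
      ← Complex.exp_nat_mul]
    have h2 : Complex.exp (2 * Real.pi * Complex.I * (∑ j, h j * m n j : ℤ)) = 1 := by
      rw [mul_comm]
      exact Complex.exp_int_mul_two_pi_mul_I _
    rw [h2, mul_one]
    congr 2
    ring
  rw [pointMean]
  simp_rw [key]
  rw [← Finset.mul_sum, sum_pow_root_of_unity hN]
  split_ifs
  · rw [norm_mul, norm_mul, norm_expMode, norm_div, norm_one, one_mul,
      one_div_mul_cancel (norm_ne_zero_iff.2 hN'), one_pow]
  · simp

lemma worstCaseError_sq_of_lattice {s N : ℕ} (hN : 0 < N) {α : ℝ} (hα : 1 / 2 < α) {γ : ℕ → ℝ}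
    (hγ : ∀ j, 0 < γ j) {P : Fin N → Fin s → ℝ} {Z : ℕ → ℤ}
    {a : Fin s → ℝ} {m : Fin N → Fin s → ℤ}
    (hP : ∀ n j, P n j = (n : ℕ) * (Z j : ℝ) / N + a j + m n j) :
    worstCaseError α γ P ^ 2 = dualError s N α γ Z := by
  rw [worstCaseError_sq P hN hα hγ, dualError]
  refine tsum_congr fun h => ?_
  rw [errorTerm, norm_pointMean_sq_of_lattice hN hP]
  by_cases h0 : h = 0
  · simp [h0]
  · simp only [h0, if_false, not_false_eq_true, true_and, Ne]
    split_ifs <;> simp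

lemma worstCaseError_latticePoints_sq {s N : ℕ} (hN : 0 < N) {α : ℝ} (hα : 1 / 2 < α)
    {γ : ℕ → ℝ} (hγ : ∀ j, 0 < γ j) (z : Fin s → ℕ) :
    worstCaseError α γ (latticePoints N z) ^ 2 = dualError s N α γ (extendByZero z) := by
  refine worstCaseError_sq_of_lattice hN hα hγ (a := 0)
    (m := fun n j => -⌊((n : ℕ) : ℝ) * (z j : ℝ) / (N : ℝ)⌋) fun n j => ?_
  simp only [latticePoints, extendByZero, Fin.is_lt, dif_pos, Pi.zero_apply, add_zero]
  push_cast
  rw [Int.fract, sub_eq_add_neg]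

/-- The frozen coordinates have generator 0 and shift c, so the anchor drops out of the error. -/
lemma worstCaseError_truncatedPoints_sq {s d N : ℕ} (hN : 0 < N) {α : ℝ} (hα : 1 / 2 < α)
    {γ : ℕ → ℝ} (hγ : ∀ j, 0 < γ j) (z : Fin d → ℕ) (c : {j : Fin s // d ≤ j.val} → ℝ) :
    worstCaseError α γ (truncatedPoints N s d z c) ^ 2 =
      dualError s N α γ (extendByZero z) := by
  refine worstCaseError_sq_of_lattice hN hα hγ
    (a := fun j => if hj : d ≤ j.val then c ⟨j, hj⟩ else 0)
    (m := fun n j => -⌊((n : ℕ) : ℝ) * (extendByZero z j : ℝ) / (N : ℝ)⌋) fun n j => ?_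
  by_cases hj : d ≤ j.val
  · simp [truncatedPoints, extendByZero, hj, not_lt.2 hj]
  · simp only [truncatedPoints, latticePoints, extendByZero, hj, not_le.1 hj, dif_pos,
      dif_neg, not_false_eq_true, add_zero]
    push_cast
    rw [Int.fract, sub_eq_add_neg]

/-- What minimality means for the dual sums: replacing a component by a generator coprime to `N`
does not decrease the error of the initial part. -/
lemma IsCBC.dualError_le {d N : ℕ} {α : ℝ} (hα : 1 / 2 < α) {γ : ℕ → ℝ} (hγ : ∀ j, 0 < γ j)
    {z : Fin d → ℕ} (hz : IsCBC N α γ z) (hN : 1 < N) {j w : ℕ} (hj : j < d) (hw : w < N)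
    (hwN : N.Coprime w) :
    dualIncrement j N α γ (extendByZero z) (extendByZero z j) ≤
      dualIncrement j N α γ (extendByZero z) w := by
  have hw0 : w ∈ Finset.Icc 1 (N - 1) := by
    have : w ≠ 0 := by
      rintro rfl
      simp at hwN
      omega
    rw [Finset.mem_Icc]
    omega
  -- The first component is prescribed, not minimized; but N ∣ kw is equivalent to N ∣ k for w
  -- coprime to N, so equality holds there.
  rcases Nat.eq_zero_or_pos j with rfl | hj0
  · have h1 : extendByZero z 0 = 1 := by
      simp [extendByZero, hj, hz.first ⟨0, hj⟩ rfl]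
    have hdvd (k : ℤ) : (N : ℤ) ∣ k * w ↔ (N : ℤ) ∣ k :=
      ⟨(Nat.isCoprime_iff_coprime.2 hwN).dvd_of_dvd_mul_right, fun h => h.mul_right _⟩
    rw [h1]
    simp [dualIncrement, hdvd]
  · have h := hz.argmin ⟨j, hj⟩ hj0 w hw0
    rw [worstCaseError_latticePoints_sq (by omega) hα hγ,
      worstCaseError_latticePoints_sq (by omega) hα hγ, dualError_succ _ _ _ hγ,
      dualError_succ _ _ _ hγ] at h
    have e1 (i : ℕ) (hi : i < j) :
        extendByZero (initialPart z ⟨j, hj⟩) i = extendByZero z i := by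
      simp [extendByZero, initialPart, hi.trans hj, hi.trans (Nat.lt_succ_self j)]
    have e2 (i : ℕ) (hi : i < j) : extendByZero (Function.update (initialPart z ⟨j, hj⟩)
        (Fin.last j) w) i = extendByZero z i := by
      have hi' : i < (⟨j, hj⟩ : Fin d).val + 1 := hi.trans (Nat.lt_succ_self j)
      rw [← e1 i hi, extendByZero, extendByZero, dif_pos hi', dif_pos hi',
        Function.update_of_ne]
      rw [Ne, Fin.ext_iff]
      simpa using hi.ne
    have e3 : extendByZero (initialPart z ⟨j, hj⟩) j = extendByZero z j := by
      simp [extendByZero, initialPart, hj]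
    have e4 : extendByZero (Function.update (initialPart z ⟨j, hj⟩)
        (Fin.last j) w) j = w := by
      have : (⟨j, Nat.lt_succ_self j⟩ : Fin (j + 1)) = Fin.last j := rfl
      rw [extendByZero, dif_pos (Nat.lt_succ_self j), this, Function.update_self]
    simp only at h
    rw [dualError_congr e1, dualError_congr e2, dualIncrement_congr e1, dualIncrement_congr e2,
      e3, e4] at h
    exact (ENNReal.add_le_add_iff_left (dualError_ne_top hα hγ j N _)).1 h

/-! ### Averaging over generators coprime to N -/

lemma ENNReal.rpow_tsum_le_tsum_rpow {ι : Type*} (f : ι → ENNReal) {p : ℝ} (hp : 0 < p)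
    (hp1 : p ≤ 1) : (∑' i, f i) ^ p ≤ ∑' i, f i ^ p := by
  have hfin (t : Finset ι) : (∑ i ∈ t, f i) ^ p ≤ ∑ i ∈ t, f i ^ p := by
    classical
    induction t using Finset.induction_on with
    | empty => simp [ENNReal.zero_rpow_of_pos hp]
    | insert a t ha ih =>
      rw [Finset.sum_insert ha, Finset.sum_insert ha]
      exact (ENNReal.rpow_add_le_add_rpow _ _ hp.le hp1).trans (by gcongr)
  rw [← ENNReal.le_rpow_inv_iff hp, ENNReal.tsum_eq_iSup_sum]
  refine iSup_le fun t => (ENNReal.le_rpow_inv_iff hp).2 ((hfin t).trans ?_)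
  exact ENNReal.sum_le_tsum t

/-- Let g = gcd(b, N) and N = gM. A solution w is invertible mod g, which forces k = gκ. Then κ is
coprime to M, so all solutions lie in one class mod M, leaving at most g of them below N. -/
lemma card_coprime_dvd_add_mul_le {N : ℕ} (hN : 0 < N) (b k : ℤ) :
    (((Finset.range N).filter fun w => N.Coprime w).filter
      fun w : ℕ => (N : ℤ) ∣ b + k * w).card ≤
      if (Int.gcd b N : ℤ) ∣ k then Int.gcd b N else 0 := by
  set g := Int.gcd b N with hg
  have hg0 : 0 < g := Int.gcd_pos_of_ne_zero_right _ (by exact_mod_cast hN.ne')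
  have hgb : (g : ℤ) ∣ b := Int.gcd_dvd_left _ _
  have hgN : (g : ℤ) ∣ N := Int.gcd_dvd_right _ _
  rcases Finset.eq_empty_or_nonempty (((Finset.range N).filter fun w => N.Coprime w).filter
      fun w : ℕ => (N : ℤ) ∣ b + k * w) with he | ⟨w₀, hw₀⟩
  · rw [he, Finset.card_empty]
    exact Nat.zero_le _
  simp only [Finset.mem_filter, Finset.mem_range] at hw₀
  have hgk : (g : ℤ) ∣ k := by
    have h1 : (g : ℤ) ∣ k * w₀ := (dvd_add_right hgb).1 (hgN.trans hw₀.2)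
    have h2 : IsCoprime (g : ℤ) (w₀ : ℤ) :=
      Nat.isCoprime_iff_coprime.2 (hw₀.1.2.coprime_dvd_left (Int.natCast_dvd_natCast.1 hgN))
    exact h2.dvd_of_dvd_mul_right h1
  rw [if_pos hgk]
  obtain ⟨M, hM⟩ := Int.natCast_dvd_natCast.1 hgN
  have hM0 : 0 < M := Nat.pos_of_mul_pos_left (hM ▸ hN)
  obtain ⟨κ, hκ⟩ := hgk
  have hcop : IsCoprime (M : ℤ) κ := by
    rw [Int.isCoprime_iff_gcd_eq_one]
    -- With t = gcd(M, κ), gt divides N and k w₀, hence also b, hence gcd(b, N) = g.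
    have h1 : g * Int.gcd M κ ∣ g := by
      rw [hg]
      refine Int.natCast_dvd_natCast.1 (Int.dvd_coe_gcd ?_ ?_) <;> rw [← hg]
      · have h3 : ((g * Int.gcd M κ : ℕ) : ℤ) ∣ k * w₀ := by
          rw [hκ, Nat.cast_mul]
          exact (mul_dvd_mul_left _ (Int.gcd_dvd_right _ _)).trans (dvd_mul_right _ _)
        have h4 : ((g * Int.gcd M κ : ℕ) : ℤ) ∣ N := by
          rw [hM, Nat.cast_mul, Nat.cast_mul]
          exact mul_dvd_mul_left _ (Int.gcd_dvd_left _ _)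
        exact (dvd_add_left h3).1 (h4.trans hw₀.2)
      · rw [hM, Nat.cast_mul, Nat.cast_mul]
        exact mul_dvd_mul_left _ (Int.gcd_dvd_left _ _)
    have h2 : g * Int.gcd M κ ∣ g * 1 := by rwa [mul_one]
    exact Nat.dvd_one.1 (Nat.dvd_of_mul_dvd_mul_left hg0 h2)
  rw [← Finset.card_range g]
  refine Finset.card_le_card_of_injOn (fun w => w / M) (fun w hw => ?_) fun w hw w' hw' h => ?_
  · simp only [Finset.coe_filter, Finset.mem_filter, Finset.mem_range, Set.mem_ofPred_eq] at hw
    simp only [Finset.coe_range, Set.mem_Iio]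
    rw [Nat.div_lt_iff_lt_mul hM0, ← hM]
    exact hw.1.1
  · simp only [Finset.coe_filter, Finset.mem_filter, Finset.mem_range, Set.mem_ofPred_eq]
      at hw hw' h
    have h1 : (N : ℤ) ∣ k * (w - w') := by
      have := dvd_sub hw.2 hw'.2
      rwa [add_sub_add_left_eq_sub, ← mul_sub] at this
    have h2 : (M : ℤ) ∣ w - w' := by
      rw [hM, hκ, Nat.cast_mul, mul_assoc] at h1
      exact hcop.dvd_of_dvd_mul_left
        (Int.dvd_of_mul_dvd_mul_left (by exact_mod_cast hg0.ne') h1)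
    have h3 : w' % M = w % M := (Nat.modEq_iff_dvd.2 h2 : w' ≡ w [MOD M])
    rw [← Nat.div_add_mod w M, ← Nat.div_add_mod w' M, h, h3]

/-- Only k = gm contributes, with multiplicity at most g, and g/g^{2α} ≤ 1 since 2α > 1. The bound
does not depend on b, so it can be used for every h separately. -/
lemma sum_coprime_tsum_le {N : ℕ} (hN : 0 < N) {α c : ℝ} (hα : 1 / 2 < α) (hc : 0 ≤ c) (b : ℤ) :
    ∑ w ∈ (Finset.range N).filter (fun w => N.Coprime w), ∑' k : ℤ,
      (if k ≠ 0 ∧ (N : ℤ) ∣ b + k * w then ENNReal.ofReal (c / |(k : ℝ)| ^ (2 * α)) else 0) ≤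
      ENNReal.ofReal (2 * c * realZeta (2 * α)) := by
  set g := Int.gcd b N with hg
  have hg0 : 0 < g := Int.gcd_pos_of_ne_zero_right _ (by exact_mod_cast hN.ne')
  have hg0' : (g : ℤ) ≠ 0 := by exact_mod_cast hg0.ne'
  have h1 (k : ℤ) : ∑ w ∈ (Finset.range N).filter (fun w => N.Coprime w),
      (if k ≠ 0 ∧ (N : ℤ) ∣ b + k * w then ENNReal.ofReal (c / |(k : ℝ)| ^ (2 * α)) else 0) ≤
      if k ≠ 0 ∧ (g : ℤ) ∣ k then g * ENNReal.ofReal (c / |(k : ℝ)| ^ (2 * α)) else 0 := by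
    by_cases hk : k = 0
    · simp [hk]
    · simp only [Ne, hk, not_false_eq_true, true_and]
      rw [← Finset.sum_filter, Finset.sum_const, nsmul_eq_mul]
      have h := card_coprime_dvd_add_mul_le hN b k
      rw [← hg] at h
      split_ifs at h ⊢ with hd
      · gcongr
      · simp [Nat.le_zero.1 h]
  rw [← Summable.tsum_finsetSum fun _ _ => ENNReal.summable]
  refine (ENNReal.tsum_le_tsum h1).trans ?_
  rw [← Function.Injective.tsum_eq (g := fun m : ℤ => (g : ℤ) * m)
    (mul_right_injective₀ hg0'), ← tsum_weight_ne_zero hα hc]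
  · refine ENNReal.tsum_le_tsum fun m => ?_
    by_cases hm : m = 0
    · simp [hm]
    · simp only [Ne, mul_eq_zero, hg0', hm, or_self, not_false_eq_true, dvd_mul_right, and_self,
        if_true, if_false]
      rw [← ENNReal.ofReal_natCast, ← ENNReal.ofReal_mul (Nat.cast_nonneg g)]
      refine ENNReal.ofReal_le_ofReal ?_
      have hg1 : (1 : ℝ) ≤ g := by exact_mod_cast hg0
      have hm0 : 0 < |(m : ℝ)| ^ (2 * α) := by
        have : 0 < |(m : ℝ)| := by simpa using hm
        positivity
      have hgp : (g : ℝ) ≤ (g : ℝ) ^ (2 * α) :=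
        Real.self_le_rpow_of_one_le hg1 (by linarith)
      push_cast
      rw [abs_mul, Nat.abs_cast, Real.mul_rpow (by positivity) (abs_nonneg _), mul_div_assoc',
        div_le_div_iff₀ (by positivity) hm0]
      calc (g : ℝ) * c * |(m : ℝ)| ^ (2 * α)
          ≤ (g : ℝ) ^ (2 * α) * c * |(m : ℝ)| ^ (2 * α) := by gcongr
        _ = _ := by ring
  · intro k hk
    by_contra hk'
    refine hk (if_neg fun H => hk' ?_)
    obtain ⟨m, hm⟩ := H.2
    exact ⟨m, hm.symm⟩

lemma sum_dualIncrement_le {N : ℕ} (hN : 0 < N) {α : ℝ} (hα : 1 / 2 < α) {γ : ℕ → ℝ}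
    (hγ : ∀ j, 0 < γ j) (s : ℕ) (Z : ℕ → ℤ) :
    ∑ w ∈ (Finset.range N).filter (fun w => N.Coprime w), dualIncrement s N α γ Z w ≤
      ENNReal.ofReal (∏ j ∈ Finset.range s, (1 + 2 * γ j * realZeta (2 * α))) *
        ENNReal.ofReal (2 * γ s * realZeta (2 * α)) := by
  simp_rw [dualIncrement]
  rw [← Summable.tsum_finsetSum fun _ _ => ENNReal.summable, ← tsum_korobovR hα hγ,
    ← ENNReal.tsum_mul_right]
  refine ENNReal.tsum_le_tsum fun h => ?_
  simp_rw [← mul_ite_zero, ENNReal.tsum_mul_left]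
  rw [← Finset.mul_sum]
  gcongr
  exact sum_coprime_tsum_le hN hα (hγ s).le _

lemma dualIncrement_rpow_le (s N : ℕ) (α : ℝ) {γ : ℕ → ℝ} (hγ : ∀ j, 0 < γ j) {lam : ℝ}
    (h0 : 0 < lam) (h1 : lam ≤ 1) (Z : ℕ → ℤ) (w : ℤ) :
    dualIncrement s N α γ Z w ^ lam ≤
      dualIncrement s N (α * lam) (fun j => γ j ^ lam) Z w := by
  refine (ENNReal.rpow_tsum_le_tsum_rpow _ h0 h1).trans (ENNReal.tsum_le_tsum fun h => ?_)
  refine (ENNReal.rpow_tsum_le_tsum_rpow _ h0 h1).trans (ENNReal.tsum_le_tsum fun k => ?_)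
  split_ifs
  · have hk : 0 ≤ γ s / |(k : ℝ)| ^ (2 * α) := by
      have := hγ s
      positivity
    rw [ENNReal.mul_rpow_of_nonneg _ _ h0.le,
      ENNReal.ofReal_rpow_of_nonneg (korobovR_pos s α hγ h).le h0.le,
      ENNReal.ofReal_rpow_of_nonneg hk h0.le, korobovR_rpow s α hγ,
      Real.div_rpow (hγ s).le (by positivity), ← Real.rpow_mul (abs_nonneg _), mul_assoc 2]
  · simp [ENNReal.zero_rpow_of_pos h0]

/-- The error bound for the component-by-component algorithm. -/
theorem IsCBC.totient_mul_dualError_rpow_le {d N : ℕ} {α : ℝ} {γ : ℕ → ℝ} (hγ : ∀ j, 0 < γ j)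
    {z : Fin d → ℕ} (hz : IsCBC N α γ z) (hN : 1 < N) {lam : ℝ} (h0 : 0 < lam) (h1 : lam ≤ 1)
    (hlam : 1 / 2 < α * lam) {j : ℕ} (hj : j ≤ d) :
    N.totient * dualError j N α γ (extendByZero z) ^ lam + 1 ≤
      ENNReal.ofReal (∏ i ∈ Finset.range j, (1 + 2 * γ i ^ lam * realZeta (2 * (α * lam)))) := by
  have hα : 1 / 2 < α := by nlinarith
  have hzeta : 0 ≤ realZeta (2 * (α * lam)) := realZeta_nonneg (by linarith)
  have hγl (i : ℕ) : 0 < γ i ^ lam := Real.rpow_pos_of_pos (hγ i) lam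
  have hterm (i : ℕ) : 0 ≤ 2 * γ i ^ lam * realZeta (2 * (α * lam)) := by
    have := hγl i
    positivity
  induction j with
  | zero => simp [dualError_zero, ENNReal.zero_rpow_of_pos h0]
  | succ j ih =>
    set Z := extendByZero z
    have hinc : N.totient * dualIncrement j N α γ Z (Z j) ^ lam ≤
        ENNReal.ofReal (∏ i ∈ Finset.range j, (1 + 2 * γ i ^ lam * realZeta (2 * (α * lam)))) *
          ENNReal.ofReal (2 * γ j ^ lam * realZeta (2 * (α * lam))) := by
      rw [Nat.totient_eq_card_coprime, ← nsmul_eq_mul]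
      refine le_trans ?_ (sum_dualIncrement_le (zero_lt_one.trans hN) hlam hγl j Z)
      -- The chosen increment is at most each of the φ(N) competing ones, hence φ(N) times its λ-th
      -- power is at most their sum.
      refine Finset.card_nsmul_le_sum _ _ _ fun w hw => ?_
      rw [Finset.mem_filter, Finset.mem_range] at hw
      refine le_trans ?_ (dualIncrement_rpow_le j N α hγ h0 h1 Z w)
      exact ENNReal.rpow_le_rpow (hz.dualError_le hα hγ hN hj hw.1 hw.2) h0.le
    -- The product grows by exactly the bound on the increment: Π(1 + x) = Π + Πx. The + 1 on the
    -- left matches the empty product at j = 0.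
    rw [dualError_succ j N α hγ, Finset.prod_range_succ, ENNReal.ofReal_mul
      (Finset.prod_nonneg fun i _ => by linarith [hterm i]), ENNReal.ofReal_add zero_le_one
      (hterm j), ENNReal.ofReal_one, mul_add, mul_one]
    calc N.totient * (dualError j N α γ Z + dualIncrement j N α γ Z (Z j)) ^ lam + 1
        ≤ N.totient * (dualError j N α γ Z ^ lam + dualIncrement j N α γ Z (Z j) ^ lam) + 1 := by
          gcongr
          exact ENNReal.rpow_add_le_add_rpow _ _ h0.le h1
      _ = (N.totient * dualError j N α γ Z ^ lam + 1) +
          N.totient * dualIncrement j N α γ Z (Z j) ^ lam := by ring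
      _ ≤ _ := add_le_add (ih (by omega)) hinc

/-! ### Decay of the weights and elementary estimates -/

lemma sum_one_div_rpow_le_realZeta {p : ℝ} (hp : 1 < p) (t : Finset ℕ) :
    ∑ j ∈ t, 1 / ((j : ℝ) + 1) ^ p ≤ realZeta p := by
  rw [realZeta_eq_tsum hp]
  exact (summable_one_div_nat_add_one_rpow hp).sum_le_tsum t fun j _ => by positivity

/-- Comparison with the integral of x^{-p} from d to s; the terms are values at right endpoints, so
the integral starts at d itself. -/
lemma sum_Ico_one_div_rpow_le {p : ℝ} (hp : 1 < p) {d s : ℕ} (hd : 0 < d) (hds : d ≤ s) :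
    ∑ j ∈ Finset.Ico d s, 1 / ((j : ℝ) + 1) ^ p ≤ 1 / (d : ℝ) ^ (p - 1) * (1 / (p - 1)) := by
  have hd0 : (0 : ℝ) < d := by exact_mod_cast hd
  have hds' : (d : ℝ) ≤ s := by exact_mod_cast hds
  have hanti : AntitoneOn (fun x : ℝ => x ^ (-p)) (Set.Icc (d : ℝ) s) := fun x hx y _ hxy =>
    Real.rpow_le_rpow_of_nonpos (hd0.trans_le hx.1) hxy (by linarith)
  have h := hanti.sum_le_integral_Ico hds
  have h0 : (0 : ℝ) ∉ Set.uIcc (d : ℝ) s := by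
    rw [Set.uIcc_of_le hds']
    exact fun H => absurd H.1 (not_le.2 hd0)
  rw [integral_rpow (Or.inr ⟨by linarith, h0⟩)] at h
  have hs0 : (0 : ℝ) ≤ (s : ℝ) ^ (-p + 1) := by positivity
  calc ∑ j ∈ Finset.Ico d s, 1 / ((j : ℝ) + 1) ^ p
      = ∑ j ∈ Finset.Ico d s, ((j + 1 : ℕ) : ℝ) ^ (-p) := by
        refine Finset.sum_congr rfl fun j _ => ?_
        rw [Real.rpow_neg (by positivity)]
        push_cast
        rw [one_div]
    _ ≤ _ := h
    _ = ((d : ℝ) ^ (-p + 1) - (s : ℝ) ^ (-p + 1)) / (p - 1) := by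
        rw [← neg_div_neg_eq]
        ring_nf
    _ ≤ (d : ℝ) ^ (-p + 1) / (p - 1) := by
        have : 0 < p - 1 := by linarith
        gcongr
        linarith
    _ = _ := by
        rw [show -p + 1 = -(p - 1) by ring, Real.rpow_neg hd0.le, div_eq_mul_one_div, one_div, one_div]

/-- Decreasing weights with `∑ γ_j^q < ∞` decay like `j^{-1/q}`. -/
lemma Antitone.le_mul_one_div_rpow {γ : ℕ → ℝ} (hanti : Antitone γ) (hγ : ∀ j, 0 < γ j) {q : ℝ}
    (hq : 0 < q) (hsum : Summable fun j => γ j ^ q) (j : ℕ) :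
    γ j ≤ (∑' i, γ i ^ q) ^ (1 / q) * (1 / ((j : ℝ) + 1) ^ (1 / q)) := by
  have h0 (i : ℕ) : 0 ≤ γ i ^ q := (Real.rpow_pos_of_pos (hγ i) q).le
  -- By monotonicity each of the first j + 1 terms is at least γ_j^q.
  have h1 : ((j : ℝ) + 1) * γ j ^ q ≤ ∑' i, γ i ^ q := by
    refine le_trans ?_ (hsum.sum_le_tsum (Finset.range (j + 1)) fun i _ => h0 i)
    have := Finset.card_nsmul_le_sum (Finset.range (j + 1)) (fun i => γ i ^ q) (γ j ^ q)
      fun i hi => Real.rpow_le_rpow (hγ j).le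
        (hanti (Nat.lt_succ_iff.1 (Finset.mem_range.1 hi))) hq.le
    simpa using this
  have hj : (0 : ℝ) < (j : ℝ) + 1 := by positivity
  calc γ j = (γ j ^ q) ^ (1 / q) := by
        rw [← Real.rpow_mul (hγ j).le, mul_one_div_cancel hq.ne', Real.rpow_one]
    _ ≤ ((∑' i, γ i ^ q) / ((j : ℝ) + 1)) ^ (1 / q) := by
        refine Real.rpow_le_rpow (h0 j) ?_ (by positivity)
        rw [le_div_iff₀ hj]
        linarith
    _ = _ := by rw [Real.div_rpow (tsum_nonneg h0) hj.le, div_eq_mul_one_div]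

lemma prod_one_add_le_exp {t : Finset ℕ} {u : ℕ → ℝ} {B : ℝ} (hu : ∀ j, 0 ≤ u j)
    (hB : ∑ j ∈ t, u j ≤ B) : ∏ j ∈ t, (1 + u j) ≤ Real.exp B := by
  refine le_trans ?_ (Real.exp_le_exp.2 hB)
  rw [Real.exp_sum]
  exact Finset.prod_le_prod (fun j _ => by linarith [hu j]) fun j _ => by
    linarith [Real.add_one_le_exp (u j)]

/-- Convexity of exp between 0 and x. -/
lemma exp_mul_sub_one_le {t x : ℝ} (ht0 : 0 ≤ t) (ht1 : t ≤ 1) :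
    Real.exp (t * x) - 1 ≤ t * (-1 + Real.exp x) := by
  have := convexOn_exp.2 (Set.mem_univ x) (Set.mem_univ 0) ht0 (sub_nonneg.2 ht1) (by ring)
  simp only [smul_eq_mul, mul_zero, add_zero, Real.exp_zero, mul_one] at this
  linarith

/-! ### Assembling the bound -/

theorem theorem2 (γ : ℕ → ℝ) (hγ_anti : Antitone γ) (hγ_pos : ∀ j, 0 < γ j)
    (lamStar : ℝ) (hlamStar_pos : 0 < lamStar) (hlamStar_lt : lamStar < 1)
    (hsum : Summable fun j => γ j ^ lamStar) :
    ∃ C : ℝ, 0 < C ∧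
      ∀ (α : ℝ), 1 / 2 < α →
      ∀ (N s d : ℕ), 0 < N → 0 < d → d < s →
      ∀ z : Fin d → ℕ, IsCBC N α γ z →
      ∀ c : {j : Fin s // d ≤ j.val} → ℝ, (∀ j, c j ∈ Set.Ico (0 : ℝ) 1) →
      ∀ lam : ℝ, max lamStar (1 / (2 * α)) < lam → lam ≤ 1 →
        worstCaseError α γ (truncatedPoints N s d z c) ^ 2 ≤
          ENNReal.ofReal
            ((1 / (Nat.totient N : ℝ) *
                (-1 + Real.exp (2 * C ^ lam * realZeta (2 * α * lam) *
                  realZeta (lam / lamStar)))) ^ (1 / lam) *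
              Real.exp (2 * C * realZeta (2 * α) * realZeta (1 / lamStar)) +
            1 / (d : ℝ) ^ (1 / lamStar - 1) *
              (-1 + Real.exp (2 * C * realZeta (2 * α) / (1 / lamStar - 1)))) := by
  have hpow (j : ℕ) : 0 < γ j ^ lamStar := Real.rpow_pos_of_pos (hγ_pos j) _
  have hS : 0 < ∑' j, γ j ^ lamStar := hsum.tsum_pos (fun j => (hpow j).le) 0 (hpow 0)
  have hdecay := hγ_anti.le_mul_one_div_rpow hγ_pos hlamStar_pos hsum
  have hC : 0 < (∑' j, γ j ^ lamStar) ^ (1 / lamStar) := Real.rpow_pos_of_pos hS _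
  -- This is the constant C; it is fixed before α, N, s, d and λ.
  generalize (∑' j, γ j ^ lamStar) ^ (1 / lamStar) = C at hdecay hC
  refine ⟨C, hC, fun α hα N s d hN hd hds z hz c _ lam hlam hlam1 => ?_⟩
  obtain ⟨hlam_star, hlam_α⟩ := max_lt_iff.1 hlam
  have hlam0 : 0 < lam := hlamStar_pos.trans hlam_star
  have hαlam : 1 / 2 < α * lam := by
    rw [div_lt_iff₀ (by linarith)] at hlam_α
    linarith
  have hp : 1 < 1 / lamStar := by rwa [lt_div_iff₀ hlamStar_pos, one_mul]
  have hq : 1 < lam / lamStar := by rwa [lt_div_iff₀ hlamStar_pos, one_mul]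
  have hN1 : 1 < N := by
    have := Finset.mem_Icc.1 (hz.mem ⟨0, hd⟩)
    omega
  have hζ : 0 ≤ realZeta (2 * α) := realZeta_nonneg (by linarith)
  have hζl : 0 ≤ realZeta (2 * (α * lam)) := realZeta_nonneg (by linarith)
  have hφ : (0 : ℝ) < N.totient := by exact_mod_cast Nat.totient_pos.2 hN
  have hd0 : (0 : ℝ) < d := by exact_mod_cast hd
  rw [worstCaseError_truncatedPoints_sq hN hα hγ_pos]
  have hZ0 (j : ℕ) (hj : d ≤ j) : extendByZero z j = 0 := dif_neg (not_lt.2 hj)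
  have htrunc := one_add_dualError_of_eq_zero hα hγ_pos hds.le N hZ0
  have hcbc := hz.totient_mul_dualError_rpow_le hγ_pos hN1 hlam0 hlam1 hαlam le_rfl
  have hu (j : ℕ) : 0 ≤ 2 * γ j * realZeta (2 * α) := by
    have := hγ_pos j
    positivity
  have hul (j : ℕ) : 0 ≤ 2 * γ j ^ lam * realZeta (2 * (α * lam)) := by
    have := Real.rpow_pos_of_pos (hγ_pos j) lam
    positivity
  -- pass to real numbers
  obtain ⟨e, he0, he⟩ : ∃ e : ℝ, 0 ≤ e ∧
      dualError d N α γ (extendByZero z) = ENNReal.ofReal e :=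
    ⟨_, ENNReal.toReal_nonneg, (ENNReal.ofReal_toReal (dualError_ne_top hα hγ_pos d N _)).symm⟩
  obtain ⟨E, hE0, hE⟩ : ∃ E : ℝ, 0 ≤ E ∧
      dualError s N α γ (extendByZero z) = ENNReal.ofReal E :=
    ⟨_, ENNReal.toReal_nonneg, (ENNReal.ofReal_toReal (dualError_ne_top hα hγ_pos s N _)).symm⟩
  set Q := ∏ j ∈ Finset.Ico d s, (1 + 2 * γ j * realZeta (2 * α))
  have hQ0 : 0 ≤ Q := Finset.prod_nonneg fun j _ => by linarith [hu j]
  rw [he, hE, ← ENNReal.ofReal_one, ← ENNReal.ofReal_add zero_le_one hE0,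
    ← ENNReal.ofReal_add zero_le_one he0, ← ENNReal.ofReal_mul (by linarith),
    ENNReal.ofReal_eq_ofReal_iff (by linarith) (by positivity)] at htrunc
  have hel : 0 ≤ e ^ lam := Real.rpow_nonneg he0 lam
  rw [he, ENNReal.ofReal_rpow_of_nonneg he0 hlam0.le, ← ENNReal.ofReal_natCast,
    ← ENNReal.ofReal_mul hφ.le, ← ENNReal.ofReal_one,
    ← ENNReal.ofReal_add (by positivity) zero_le_one, ENNReal.ofReal_le_ofReal_iff
    (Finset.prod_nonneg fun j _ => by linarith [hul j])] at hcbc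
  rw [hE]
  refine ENNReal.ofReal_le_ofReal ?_
  have hγlam (j : ℕ) : γ j ^ lam ≤ C ^ lam * (1 / ((j : ℝ) + 1) ^ (lam / lamStar)) := by
    refine (Real.rpow_le_rpow (hγ_pos j).le (hdecay j) hlam0.le).trans_eq ?_
    rw [Real.mul_rpow hC.le (by positivity), Real.div_rpow zero_le_one (by positivity),
      Real.one_rpow, ← Real.rpow_mul (by positivity), one_div_mul_eq_div]
  have hsum1 : ∑ j ∈ Finset.range d, 2 * γ j ^ lam * realZeta (2 * (α * lam)) ≤
      2 * C ^ lam * realZeta (2 * α * lam) * realZeta (lam / lamStar) := by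
    rw [mul_assoc 2 α lam]
    calc ∑ j ∈ Finset.range d, 2 * γ j ^ lam * realZeta (2 * (α * lam))
        ≤ ∑ j ∈ Finset.range d, 2 * C ^ lam * realZeta (2 * (α * lam)) *
            (1 / ((j : ℝ) + 1) ^ (lam / lamStar)) := by
          refine Finset.sum_le_sum fun j _ => ?_
          have := mul_le_mul_of_nonneg_right (hγlam j) hζl
          linarith
      _ ≤ _ := by
          rw [← Finset.mul_sum]
          exact mul_le_mul_of_nonneg_left (sum_one_div_rpow_le_realZeta hq _) (by positivity)
  -- B is used twice: as ζ(1/λ*) for the factor Q, and as the tail bound with its power of d for Q -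
  -- 1.
  have hsumI (B : ℝ) (hB : ∑ j ∈ Finset.Ico d s, 1 / ((j : ℝ) + 1) ^ (1 / lamStar) ≤ B) :
      Q ≤ Real.exp (2 * C * realZeta (2 * α) * B) := by
    refine prod_one_add_le_exp hu ?_
    calc ∑ j ∈ Finset.Ico d s, 2 * γ j * realZeta (2 * α)
        ≤ ∑ j ∈ Finset.Ico d s, 2 * C * realZeta (2 * α) *
            (1 / ((j : ℝ) + 1) ^ (1 / lamStar)) := by
          refine Finset.sum_le_sum fun j _ => ?_
          have := mul_le_mul_of_nonneg_right (hdecay j) hζ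
          linarith
      _ ≤ _ := by
          rw [← Finset.mul_sum]
          exact mul_le_mul_of_nonneg_left hB (by positivity)
  have hQ1 := hsumI _ (sum_one_div_rpow_le_realZeta hp _)
  have hQ2 : Q - 1 ≤ 1 / (d : ℝ) ^ (1 / lamStar - 1) *
      (-1 + Real.exp (2 * C * realZeta (2 * α) / (1 / lamStar - 1))) := by
    -- Here t = d^{-(1/λ* - 1)}, which is at most 1 because d ≥ 1.
    refine le_trans ?_ (exp_mul_sub_one_le (by positivity) ?_)
    · refine sub_le_sub_right ((hsumI _ (sum_Ico_one_div_rpow_le hp hd hds.le)).trans_eq ?_) 1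
      congr 1
      ring
    · rw [div_le_one (by positivity)]
      exact Real.one_le_rpow (by exact_mod_cast hd) (by linarith)
  have he1 : e ≤ (1 / (Nat.totient N : ℝ) * (-1 + Real.exp (2 * C ^ lam *
      realZeta (2 * α * lam) * realZeta (lam / lamStar)))) ^ (1 / lam) := by
    have h1 := hcbc.trans (prod_one_add_le_exp hul hsum1)
    have h2 : e = (e ^ lam) ^ (1 / lam) := by
      rw [← Real.rpow_mul he0, mul_one_div_cancel hlam0.ne', Real.rpow_one]
    rw [h2]
    refine Real.rpow_le_rpow hel ?_ (by positivity)
    rw [one_div_mul_eq_div, le_div_iff₀ hφ]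
    linarith
  -- A rearrangement of 1 + E = (1 + e) Q.
  have : E = e * Q + (Q - 1) := by linarith
  rw [this]
  exact add_le_add (mul_le_mul he1 hQ1 hQ0 (he0.trans he1)) hQ2
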